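/- Let $N \in \{1,2,\dots\}$ and $S \subseteq \mathbb{R}^N$. A set $L \subseteq \mathbb{R}^N$ is called $S$-free if it is closed and convex and its interior is disjoint from $S$; it is called maximal $S$-free if it is $S$-free and no $S$-free set properly contains it. Define $f(S) \in \{-\infty\} \cup \{0,1,2,\dots\} \cup \{+\infty\}$ as follows: $f(S) := -\infty$ if there is no $N$-dimensional maximal $S$-free set; otherwise $f(S)$ is the least integer $k \ge 0$ such that every $N$-dimensional maximal $S$-free set is a polyhedron with at most $k$ facets, and $f(S) := +\infty$ if there is no such $k$. Theorem. Let $d \ge 1$ and $n \ge 0$ be integers and let $C \subseteq \mathbb{R}^{d+n}$ be convex. Then $$f\bigl((\mathbb{Z}^d \times \mathbb{R}^n) \cap C\bigr) \le 2^d.$$ Furthermore, equality holds for $C = \mathbb{R}^{d+n}$, that is, $f(\mathbb{Z}^d \times \mathbb{R}^n) = 2^d$. -/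

import Mathlib

/-- `L` is `S`-free: closed, convex, and its interior is disjoint from `S`. -/
def IsSFree {N : ℕ} (S L : Set (EuclideanSpace ℝ (Fin N))) : Prop :=
  IsClosed L ∧ Convex ℝ L ∧ Disjoint (interior L) S

/-- `L` is maximal `S`-free: `S`-free and not properly contained in another `S`-free set. -/
def IsMaximalSFree {N : ℕ} (S L : Set (EuclideanSpace ℝ (Fin N))) : Prop :=
  Maximal (IsSFree S) L

/-- `L ⊆ ℝ^N` is `N`-dimensional: its affine hull is the whole space. -/
def IsFullDimensional {N : ℕ} (L : Set (EuclideanSpace ℝ (Fin N))) : Prop :=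
  affineSpan ℝ L = ⊤

/-- `P` is a polyhedron: the solution set of a finite (possibly empty) system of
non-strict linear inequalities. -/
def IsPolyhedron {N : ℕ} (P : Set (EuclideanSpace ℝ (Fin N))) : Prop :=
  ∃ (m : ℕ) (u : Fin m → EuclideanSpace ℝ (Fin N)) (β : Fin m → ℝ),
    P = {x | ∀ i, inner ℝ (u i) x ≤ β i}

/-- `F` is a facet of the polyhedron `P`: a nonempty face of `P` (a set of maximizers over `P` of
a linear functional) whose dimension is `dim P - 1`. -/
def IsFacet {N : ℕ} (P F : Set (EuclideanSpace ℝ (Fin N))) : Prop :=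
  IsExposed ℝ P F ∧ F.Nonempty ∧
    Module.finrank ℝ (vectorSpan ℝ F) + 1 = Module.finrank ℝ (vectorSpan ℝ P)

/-- Every `N`-dimensional maximal `S`-free set is a polyhedron with at most `k` facets. -/
def FacetBound {N : ℕ} (S : Set (EuclideanSpace ℝ (Fin N))) (k : ℕ) : Prop :=
  ∀ L, IsMaximalSFree S L → IsFullDimensional L →
    IsPolyhedron L ∧ {F | IsFacet L F}.encard ≤ k

open Classical in
/-- The facet complexity `f(S)` of maximal `S`-free sets: `-∞` if there is no
`N`-dimensional maximal `S`-free set; otherwise the least `k` such that every such set is a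
polyhedron with at most `k` facets, or `+∞` if there is no such `k`. -/
noncomputable def facetComplexity {N : ℕ} (S : Set (EuclideanSpace ℝ (Fin N))) : EReal :=
  if ∃ L, IsMaximalSFree S L ∧ IsFullDimensional L then
    if h : ∃ k : ℕ, FacetBound S k then ((Nat.find h : ℕ) : EReal) else ⊤
  else ⊥

/-- The set `ℤ^d × ℝ^n ⊆ ℝ^(d+n)`: the first `d` coordinates are integers. -/
def mixedInteger (d n : ℕ) : Set (EuclideanSpace ℝ (Fin (d + n))) :=
  {x | ∀ i : Fin d, ∃ z : ℤ, x (Fin.castAdd n i) = (z : ℝ)}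

/-! Upper bound: keep only finitely many points of `S` and slice their convex hull by the integer
values of the first `d` coordinates. Each nonempty slice lies in `S`, so a half-space containing `L`
has it on its boundary or outside. Slices over two integer points of equal parity average into the
slice over their midpoint, and `exists_small_cover` uses this to shift the half-spaces outward until
one per parity class, `2 ^ d` in all, suffices. Compactness (`IsMaximalSFree.exists_eq_of_finite`)
passes from finite subsets to all of `S`; maximality then makes `L` equal to the resulting
polyhedron, and `encard_facets_le` turns inequalities into facets.

Lower bound: the cross-polytope around the unit cube, times `ℝ^n`, is maximal free, and each of the
`2 ^ d` cube vertices lies on a facet of its own. -/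

/-! ### Reducing a cover by the parity argument -/

/-- Given finitely many functions on a finite set that admits common midpoints inside each of `κ`
classes, any cover by superlevel sets can be replaced by a cover by at most `card κ` superlevel sets
with higher thresholds. -/
theorem exists_small_cover {ι τ κ : Type*} [Fintype ι] [Fintype τ] [Fintype κ]
    (c : τ → κ) (g : ι → τ → ℝ)
    (hmid : ∀ z w, c z = c w → ∃ m, ∀ i, 2 * g i m ≤ g i z + g i w)
    (b : ι → ℝ) (hb : ∀ z, ∃ i, b i ≤ g i z) :
    ∃ (J : Finset ι) (b' : ι → ℝ), J.card ≤ Fintype.card κ ∧ (∀ i ∈ J, b i ≤ b' i) ∧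
      ∀ z, ∃ i ∈ J, b' i ≤ g i z := by
  classical
  -- Covers by superlevel sets above the thresholds `b`. Empty members are allowed, so passing to a
  -- minimal cover can discard indices.
  let Adm : Set (ι → Finset τ) := {A | (∀ i z w, z ∈ A i → g i z ≤ g i w → w ∈ A i) ∧
    (∀ i, ∀ z ∈ A i, b i ≤ g i z) ∧ ∀ z, ∃ i, z ∈ A i}
  have hne : Adm.Nonempty := by
    refine ⟨fun i => Finset.univ.filter fun z => b i ≤ g i z, ?_, ?_, ?_⟩
    · intro i z w hz hzw
      simp only [Finset.mem_filter, Finset.mem_univ, true_and] at hz ⊢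
      exact hz.trans hzw
    · intro i z hz
      simpa using hz
    · intro z
      simpa using hb z
  obtain ⟨A, hA⟩ := Set.Finite.exists_minimal (Set.toFinite Adm) hne
  obtain ⟨hup, hlow, hcov⟩ := hA.prop
  have key : ∀ i, (A i).Nonempty →
      ∃ z ∈ A i, (∀ w ∈ A i, g i z ≤ g i w) ∧ ∀ j, j ≠ i → z ∉ A j := by
    intro i hi
    obtain ⟨m, hm, hmin⟩ := (A i).exists_min_image (g i) hi
    by_contra! hcon
    -- Dropping the lowest level of `A i` would still leave a cover if every minimizer belonged to
    -- another member, against minimality.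
    let A' : ι → Finset τ := Function.update A i ((A i).filter fun z => g i m < g i z)
    have hle : A' ≤ A := by
      intro j
      by_cases hj : j = i
      · subst hj
        simp [A']
      · simp [A', Function.update_of_ne hj]
    have hadm : A' ∈ Adm := by
      refine ⟨?_, fun j z hz => hlow j z (hle j hz), ?_⟩
      · intro j z w hz hzw
        by_cases hj : j = i
        · subst hj
          simp only [A', Function.update_self, Finset.mem_filter] at hz ⊢
          exact ⟨hup _ z w hz.1 hzw, hz.2.trans_le hzw⟩
        · simp only [A', Function.update_of_ne hj] at hz ⊢
          exact hup _ z w hz hzw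
      · intro z
        by_cases hz : ∃ j, j ≠ i ∧ z ∈ A j
        · obtain ⟨j, hj, hzj⟩ := hz
          exact ⟨j, by simpa [A', Function.update_of_ne hj] using hzj⟩
        · push Not at hz
          obtain ⟨j, hj⟩ := hcov z
          have hji : j = i := by
            by_contra h
            exact hz j h hj
          subst hji
          refine ⟨j, ?_⟩
          simp only [A', Function.update_self, Finset.mem_filter]
          refine ⟨hj, ?_⟩
          by_contra! hlt
          obtain ⟨k, hk, hzk⟩ := hcon z hj fun w hw => hlt.trans (hmin w hw)
          exact hz k hk hzk
    have := hA.le_of_le hadm hle i hm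
    simp [A'] at this
  rcases isEmpty_or_nonempty τ with hτ | hτ
  · exact ⟨∅, b, by simp, by simp, fun z => isEmptyElim z⟩
  choose! p hpA hpmin hpout using key
  refine ⟨Finset.univ.filter fun i => (A i).Nonempty, fun i => g i (p i), ?_, ?_, ?_⟩
  · by_contra! hcard
    rw [← Finset.card_univ] at hcard
    obtain ⟨i, hi, j, hj, hij, hc⟩ := Finset.exists_ne_map_eq_of_card_lt_of_maps_to hcard
      (f := fun i => c (p i)) (fun _ _ => Finset.mem_coe.2 (Finset.mem_univ _))
    simp only [Finset.mem_filter, Finset.mem_univ, true_and] at hi hj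
    -- The midpoint `m` lies in some `A k`. Every private point satisfies `g k (p l) ≤ g k m`,
    -- strictly when `l ≠ k`; as `i` and `j` cannot both be `k`, the midpoint inequality fails.
    obtain ⟨m, hm⟩ := hmid _ _ hc
    obtain ⟨k, hk⟩ := hcov m
    have hlt : ∀ l, (A l).Nonempty → l ≠ k → g k (p l) < g k m := by
      intro l hl hlk
      by_contra! h
      exact hpout l hl k hlk.symm (hup k m _ hk h)
    have hle : ∀ l, (A l).Nonempty → g k (p l) ≤ g k m := by
      intro l hl
      by_cases hlk : l = k
      · subst hlk
        exact hpmin l hl m hk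
      · exact (hlt l hl hlk).le
    have h1 := hm k
    by_cases hik : i = k
    · have := hlt j hj (by rintro rfl; exact hij hik)
      linarith [hle i hi]
    · have := hlt i hi hik
      linarith [hle j hj]
  · intro i hi
    simp only [Finset.mem_filter, Finset.mem_univ, true_and] at hi
    exact hlow i _ (hpA i hi)
  · intro z
    obtain ⟨i, hi⟩ := hcov z
    exact ⟨i, by simpa using ⟨z, hi⟩, hpmin i ⟨z, hi⟩ z hi⟩

/-! ### From finite subsets to all of `S` by compactness -/

/-- A maximal `S`-free set is cut out by `k` inequalities as soon as every finite subset of `S` can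
be kept out of the interior by `k` valid inequalities. -/
theorem IsMaximalSFree.exists_eq_of_finite {N k : ℕ} {S L : Set (EuclideanSpace ℝ (Fin N))}
    (hL : IsMaximalSFree S L) (hne : L.Nonempty)
    (hfin : ∀ F : Finset (EuclideanSpace ℝ (Fin N)), (F : Set _) ⊆ S →
      ∃ p : Fin k → EuclideanSpace ℝ (Fin N) × ℝ, (∀ i, p i ≠ 0) ∧
        (∀ i, ∀ x ∈ L, inner ℝ (p i).1 x ≤ (p i).2) ∧
        ∀ x ∈ F, ∃ i, (p i).2 ≤ inner ℝ (p i).1 x) :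
    ∃ (u : Fin k → EuclideanSpace ℝ (Fin N)) (β : Fin k → ℝ),
      L = {x | ∀ i, inner ℝ (u i) x ≤ β i} := by
  -- The pair (normal, bound) is normalized jointly, which bounds both; a zero normal with positive
  -- bound remains as a trivial inequality.
  let K : Set (EuclideanSpace ℝ (Fin N) × ℝ) :=
    Metric.sphere 0 1 ∩ {p | ∀ x ∈ L, inner ℝ p.1 x ≤ p.2}
  have hK : IsCompact K := by
    refine (isCompact_sphere _ _).inter_right ?_
    simp only [Set.ofPred_forall]
    refine isClosed_biInter fun x _ => isClosed_le (by fun_prop) (by fun_prop)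
  have hKK : IsCompact (Set.univ.pi fun _ : Fin k => K) := isCompact_univ_pi fun _ => hK
  obtain ⟨p, hp, hpS⟩ : ((Set.univ.pi fun _ : Fin k => K) ∩ ⋂ x : S,
      {p : Fin k → EuclideanSpace ℝ (Fin N) × ℝ |
        ∃ i, (p i).2 ≤ inner ℝ (p i).1 (x : EuclideanSpace ℝ (Fin N))}).Nonempty := by
    refine hKK.inter_iInter_nonempty _ (fun x => ?_) fun t => ?_
    · simp only [Set.ofPred_exists]
      exact isClosed_iUnion_of_finite fun i => isClosed_le (by fun_prop) (by fun_prop)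
    · classical
      obtain ⟨p, hp0, hpL, hpF⟩ := hfin (t.image Subtype.val) (by
        intro x hx
        simp only [Finset.coe_image, Set.mem_image] at hx
        obtain ⟨y, _, rfl⟩ := hx
        exact y.2)
      refine ⟨fun i => ‖p i‖⁻¹ • p i, ?_, ?_⟩
      · intro i _
        refine ⟨?_, fun x hx => ?_⟩
        · simp [norm_smul, hp0 i]
        · have h := mul_le_mul_of_nonneg_left (hpL i x hx) (inv_nonneg.2 (norm_nonneg (p i)))
          simpa [inner_smul_left] using h
      · simp only [Set.mem_iInter]
        intro x hx
        obtain ⟨i, hi⟩ := hpF x (Finset.mem_image_of_mem _ hx)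
        refine ⟨i, ?_⟩
        have h := mul_le_mul_of_nonneg_left hi (inv_nonneg.2 (norm_nonneg (p i)))
        simpa [inner_smul_left] using h
  simp only [Set.mem_iInter] at hpS
  simp only [Set.mem_pi, Set.mem_univ, true_imp_iff] at hp
  refine ⟨fun i => (p i).1, fun i => (p i).2, ?_⟩
  set P : Set (EuclideanSpace ℝ (Fin N)) := {x | ∀ i, inner ℝ (p i).1 x ≤ (p i).2} with hP
  have hLP : L ⊆ P := fun x hx i => (hp i).2 x hx
  refine Set.Subset.antisymm hLP (hL.le_of_ge ⟨?_, ?_, ?_⟩ hLP)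
  · simp only [hP, Set.ofPred_forall]
    exact isClosed_iInter fun i => isClosed_le (by fun_prop) (by fun_prop)
  · intro x hx y hy a b ha hb hab i
    rw [inner_add_right, inner_smul_right, inner_smul_right]
    calc a * inner ℝ (p i).1 x + b * inner ℝ (p i).1 y ≤ a * (p i).2 + b * (p i).2 := by
          gcongr
          exacts [hx i, hy i]
      _ = (p i).2 := by rw [← add_mul, hab, one_mul]
  · rw [Set.disjoint_left]
    intro x hxP hxS
    obtain ⟨i, hi⟩ := hpS ⟨x, hxS⟩
    simp only at hi
    have hu : (p i).1 ≠ 0 := by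
      intro h0
      obtain ⟨y, hy⟩ := hne
      have h1 := (hp i).2 y hy
      have h2 : ‖p i‖ = 1 := by simpa using (hp i).1
      rw [h0, inner_zero_left] at h1 hi
      have h3 : (p i).2 = 0 := le_antisymm hi h1
      have h4 : p i = 0 := Prod.ext h0 h3
      simp [h4] at h2
    have hcont : Continuous fun t : ℝ => x + t • (p i).1 := by fun_prop
    have hmem : ∀ᶠ t : ℝ in nhds 0, x + t • (p i).1 ∈ P :=
      hcont.continuousAt.eventually_mem (by simpa using mem_interior_iff_mem_nhds.1 hxP)
    obtain ⟨t, ht, htpos⟩ := ((hmem.filter_mono nhdsWithin_le_nhds).and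
      (self_mem_nhdsWithin : Set.Ioi (0 : ℝ) ∈ nhdsWithin 0 (Set.Ioi 0))).exists
    have h1 := ht i
    rw [inner_add_right, inner_smul_right] at h1
    have h2 : 0 < t * inner ℝ (p i).1 (p i).1 :=
      mul_pos htpos (real_inner_self_pos.2 hu)
    linarith

/-! ### Facets versus inequalities -/

/-- A full-dimensional polyhedron given by `m` inequalities has at most `m` facets. -/
theorem encard_facets_le {N m : ℕ} (u : Fin m → EuclideanSpace ℝ (Fin N)) (β : Fin m → ℝ)
    (hfull : IsFullDimensional {x | ∀ i, inner ℝ (u i) x ≤ β i}) :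
    {F | IsFacet {x | ∀ i, inner ℝ (u i) x ≤ β i} F}.encard ≤ m := by
  set P : Set (EuclideanSpace ℝ (Fin N)) := {x | ∀ i, inner ℝ (u i) x ≤ β i} with hP
  have hsub : {F | IsFacet P F} ⊆ Set.range fun i => P ∩ {x | inner ℝ (u i) x = β i} := by
    rintro F ⟨hexp, hne, hdim⟩
    obtain ⟨l, hl⟩ := hexp hne
    have hPtop : vectorSpan ℝ P = ⊤ := by
      have : affineSpan ℝ P = ⊤ := hfull
      rw [← direction_affineSpan, this, AffineSubspace.direction_top]
    have hFP : F ⊆ P := hl ▸ fun x hx => hx.1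
    have hl0 : l ≠ 0 := by
      rintro rfl
      have : F = P := by
        rw [hl]
        ext x
        simp
      rw [this] at hdim
      omega
    obtain ⟨i, hi0, hi⟩ : ∃ i, u i ≠ 0 ∧ ∀ x ∈ F, inner ℝ (u i) x = β i := by
      by_contra! hcon
      choose! q hqF hq using hcon
      obtain ⟨x₀, hx₀⟩ := hne
      have hPconv : Convex ℝ P := by
        intro x hx y hy a b ha hb hab i
        rw [inner_add_right, inner_smul_right, inner_smul_right]
        calc a * inner ℝ (u i) x + b * inner ℝ (u i) y ≤ a * β i + b * β i := by
              gcongr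
              exacts [hx i, hy i]
          _ = β i := by rw [← add_mul, hab, one_mul]
      have hFconv : Convex ℝ F := IsExposed.convex (𝕜 := ℝ) hexp hPconv
      -- Averaging points of `F` that are slack for different inequalities gives a point of `F`
      -- interior to `P`, where a nonzero `l` cannot attain its maximum.
      have hstep : ∀ s : Finset (Fin m), ∃ y ∈ F, ∀ i ∈ s, u i ≠ 0 → inner ℝ (u i) y < β i := by
        classical
        intro s
        induction s using Finset.induction_on with
        | empty => exact ⟨x₀, hx₀, by simp⟩
        | insert a s _ ih =>
          obtain ⟨y, hy, hys⟩ := ih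
          by_cases ha : u a = 0
          · refine ⟨y, hy, fun i hi hi0 => ?_⟩
            rcases Finset.mem_insert.1 hi with rfl | hi
            · exact absurd ha hi0
            · exact hys i hi hi0
          · refine ⟨(1 / 2 : ℝ) • y + (1 / 2 : ℝ) • q a,
              hFconv hy (hqF a ha) (by norm_num) (by norm_num) (by norm_num), fun i hi hi0 => ?_⟩
            rw [inner_add_right, inner_smul_right, inner_smul_right]
            have h1 := hFP hy i
            have h2 := hFP (hqF a ha) i
            rcases Finset.mem_insert.1 hi with rfl | hi
            · have := lt_of_le_of_ne h2 (hq i hi0)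
              linarith
            · linarith [hys i hi hi0]
      obtain ⟨y, hyF, hy⟩ := hstep Finset.univ
      have hnear : ∀ᶠ z in nhds y, z ∈ P := by
        simp only [hP, Set.mem_ofPred_eq, Filter.eventually_all]
        intro i
        by_cases hi0 : u i = 0
        · have := hFP hyF i
          refine Filter.Eventually.of_forall fun z => ?_
          simpa [hi0] using this
        · have hc : Continuous fun z => inner ℝ (u i) z := by fun_prop
          exact (hc.continuousAt.eventually (gt_mem_nhds (hy i (Finset.mem_univ i) hi0))).mono
            fun z hz => le_of_lt hz
      apply hl0
      ext v
      have hmax : ∀ z ∈ P, l z ≤ l y := by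
        rw [hl] at hyF
        exact hyF.2
      have hle : ∀ v, l v ≤ 0 := by
        intro v
        have hcont : Continuous fun t : ℝ => y + t • v := by fun_prop
        have hmem : ∀ᶠ t : ℝ in nhds 0, y + t • v ∈ P :=
          hcont.continuousAt.eventually_mem (by simpa using hnear)
        obtain ⟨t, ht, htpos⟩ := ((hmem.filter_mono nhdsWithin_le_nhds).and
          (self_mem_nhdsWithin : Set.Ioi (0 : ℝ) ∈ nhdsWithin 0 (Set.Ioi 0))).exists
        have h1 := hmax _ ht
        rw [map_add, map_smul, smul_eq_mul] at h1
        have htpos : 0 < t := htpos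
        by_contra! h
        have := mul_pos htpos h
        linarith
      have h1 := hle v
      have h2 := hle (-v)
      rw [map_neg] at h2
      simp only [zero_apply]
      linarith
    refine ⟨i, Set.Subset.antisymm ?_ fun x hx => ⟨hFP hx, hi x hx⟩⟩
    obtain ⟨x₀, hx₀⟩ := hne
    let φ : EuclideanSpace ℝ (Fin N) →ₗ[ℝ] ℝ := (innerSL ℝ (u i)).toLinearMap
    have hφ : ∀ x, φ x = inner ℝ (u i) x := fun x => rfl
    have hφ0 : φ ≠ 0 := by
      intro h
      have := hφ (u i)
      rw [h, LinearMap.zero_apply] at this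
      exact hi0 (inner_self_eq_zero.1 this.symm)
    have hle : vectorSpan ℝ F ≤ LinearMap.ker φ := by
      rw [vectorSpan_def, Submodule.span_le]
      rintro _ ⟨a, ha, b, hb, rfl⟩
      simp [hφ, inner_sub_right, hi a ha, hi b hb]
    have hle' : vectorSpan ℝ F ≤ LinearMap.ker l.toLinearMap := by
      rw [vectorSpan_def, Submodule.span_le]
      rintro _ ⟨a, ha, b, hb, rfl⟩
      rw [hl] at ha hb
      have := le_antisymm (ha.2 b hb.1) (hb.2 a ha.1)
      simp [this]
    have hker := Module.Dual.finrank_ker_add_one_of_ne_zero hφ0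
    rw [hPtop, finrank_top] at hdim
    -- By dimension, the directions of `F` fill the hyperplane `ker φ`, so `l` is constant on the
    -- whole tight set.
    have heq := Submodule.eq_of_le_of_finrank_le hle (by omega)
    rintro x ⟨hxP, hx⟩
    have hxk : x - x₀ ∈ LinearMap.ker l.toLinearMap := by
      apply hle'
      rw [heq, LinearMap.mem_ker, map_sub, hφ, hφ, hi x₀ hx₀, sub_eq_zero]
      exact hx
    have hlx : l x = l x₀ := by
      simpa [sub_eq_zero] using hxk
    rw [hl] at hx₀ ⊢
    exact ⟨hxP, fun y hy => hlx ▸ hx₀.2 y hy⟩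
  calc _ ≤ (Set.range fun i => P ∩ {x | inner ℝ (u i) x = β i}).encard := Set.encard_le_encard hsub
    _ ≤ (Set.univ : Set (Fin m)).encard := by
      rw [← Set.image_univ]
      exact Set.encard_image_le _ _
    _ = m := by simp [Set.encard_univ]

/-! ### Separating integer slices -/

/-- Finitely many mixed-integer points of a convex set `C` can be kept out of the interior of an
`S`-free set, `S = (ℤ^d × ℝ^n) ∩ C`, by `2 ^ d` valid inequalities. -/
theorem exists_valid_inequalities {d n : ℕ} {C L : Set (EuclideanSpace ℝ (Fin (d + n)))}
    (hC : Convex ℝ C) (hL : IsSFree (mixedInteger d n ∩ C) L) (hint : (interior L).Nonempty)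
    (F : Finset (EuclideanSpace ℝ (Fin (d + n)))) (hF : (F : Set _) ⊆ mixedInteger d n ∩ C) :
    ∃ p : Fin (2 ^ d) → EuclideanSpace ℝ (Fin (d + n)) × ℝ, (∀ i, p i ≠ 0) ∧
      (∀ i, ∀ x ∈ L, inner ℝ (p i).1 x ≤ (p i).2) ∧
      ∀ x ∈ F, ∃ i, (p i).2 ≤ inner ℝ (p i).1 x := by
  classical
  obtain ⟨-, hLconv, hdisj⟩ := hL
  let Q : (Fin d → ℤ) → Set (EuclideanSpace ℝ (Fin (d + n))) := fun z =>
    convexHull ℝ (F : Set (EuclideanSpace ℝ (Fin (d + n)))) ∩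
      {x | ∀ i, x (Fin.castAdd n i) = (z i : ℝ)}
  have hW : IsCompact (convexHull ℝ (F : Set (EuclideanSpace ℝ (Fin (d + n))))) :=
    F.finite_toSet.isCompact_convexHull (𝕜 := ℝ)
  have hQmem : ∀ {z x}, x ∈ Q z ↔
      x ∈ convexHull ℝ (F : Set (EuclideanSpace ℝ (Fin (d + n)))) ∧
        ∀ i, x (Fin.castAdd n i) = (z i : ℝ) := Iff.rfl
  have hQcompact : ∀ z, IsCompact (Q z) := by
    intro z
    refine hW.inter_right ?_
    simp only [Set.ofPred_forall]
    exact isClosed_iInter fun i =>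
      isClosed_eq (EuclideanSpace.proj (𝕜 := ℝ) (Fin.castAdd n i)).continuous continuous_const
  have hQavg : ∀ {z w m : Fin d → ℤ} {s t : ℝ}, 0 ≤ s → 0 ≤ t → s + t = 1 →
      (∀ k, (m k : ℝ) = s * z k + t * w k) →
      ∀ x ∈ Q z, ∀ y ∈ Q w, s • x + t • y ∈ Q m := by
    intro z w m s t hs ht hst hm x hx y hy
    refine hQmem.2 ⟨(convex_convexHull ℝ _) hx.1 hy.1 hs ht hst, fun i => ?_⟩
    simp [hx.2 i, hy.2 i, hm i]
  have hQconv : ∀ z, Convex ℝ (Q z) := by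
    intro z x hx y hy s t hs ht hst
    exact hQavg hs ht hst (fun k => by rw [← add_mul, hst, one_mul]) x hx y hy
  have hQS : ∀ z, Q z ⊆ mixedInteger d n ∩ C := fun z x hx =>
    ⟨fun i => ⟨z i, hx.2 i⟩, convexHull_min (fun y hy => (hF hy).2) hC hx.1⟩
  let T : Set (Fin d → ℤ) := {z | (Q z).Nonempty}
  have hT : T.Finite := by
    obtain ⟨R, hR⟩ := hW.isBounded.exists_norm_le
    refine (Set.finite_Icc (fun _ : Fin d => -⌈R⌉) (fun _ => ⌈R⌉)).subset ?_
    rintro z ⟨x, hx, hxz⟩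
    have hb : ∀ i, |(z i : ℝ)| ≤ ⌈R⌉ := fun i => by
      rw [← hxz i, ← Real.norm_eq_abs]
      exact (PiLp.norm_apply_le x _).trans ((hR x hx).trans (Int.le_ceil R))
    refine ⟨fun i => ?_, fun i => ?_⟩
    · exact_mod_cast (abs_le.1 (hb i)).1
    · exact_mod_cast (abs_le.1 (hb i)).2
  have : Fintype T := hT.fintype
  have hsep : ∀ z : T, ∃ (a : EuclideanSpace ℝ (Fin (d + n))) (b : ℝ), a ≠ 0 ∧
      (∀ x ∈ L, inner ℝ a x ≤ b) ∧ ∀ x ∈ Q z, b ≤ inner ℝ a x := by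
    rintro ⟨z, hz⟩
    obtain ⟨f, b, hfU, hfQ⟩ := geometric_hahn_banach_open hLconv.interior isOpen_interior
      (hQconv z) (hdisj.mono_right (hQS z))
    have hf : ∀ x, inner ℝ ((InnerProductSpace.toDual ℝ _).symm f) x = f x := fun x =>
      InnerProductSpace.toDual_symm_apply
    refine ⟨(InnerProductSpace.toDual ℝ _).symm f, b, ?_, ?_, ?_⟩
    · intro h0
      obtain ⟨x, hx⟩ := hint
      obtain ⟨y, hy⟩ := hz
      have h1 := hfU x hx
      have h2 := hfQ y hy
      rw [← hf, h0, inner_zero_left] at h1 h2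
      linarith
    · intro x hx
      rw [hf]
      have hcl : x ∈ closure (interior L) := by
        rw [hLconv.closure_interior_eq_closure_of_nonempty_interior hint]
        exact subset_closure hx
      exact closure_minimal (fun y hy => (hfU y hy).le : interior L ⊆ {y | f y ≤ b})
        (isClosed_le f.continuous continuous_const) hcl
    · intro x hx
      rw [hf]
      exact hfQ x hx
  choose a b ha haL haQ using hsep
  have hmin : ∀ i z : T, ∃ q ∈ Q z, ∀ x ∈ Q z, inner ℝ (a i) q ≤ inner ℝ (a i) x := by
    intro i z
    obtain ⟨q, hq, hqm⟩ := (hQcompact z).exists_isMinOn z.2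
      (f := fun x => inner ℝ (a i) x) (by fun_prop)
    exact ⟨q, hq, fun x hx => hqm hx⟩
  choose q hqQ hqmin using hmin
  -- The function `g i z` is the minimum of the `i`-th normal over slice `z`; classes are parity
  -- vectors, of which there are `2 ^ d`.
  obtain ⟨J, b', hJ, hbb', hcov⟩ := exists_small_cover (κ := Fin d → ZMod 2)
    (fun z : T => fun k => ((z : Fin d → ℤ) k : ZMod 2)) (fun i z => inner ℝ (a i) (q i z))
    (by
      intro z w hzw
      let m : Fin d → ℤ := fun k => ((z : Fin d → ℤ) k + (w : Fin d → ℤ) k) / 2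
      have hm : ∀ k, (m k : ℝ) =
          1 / 2 * ((z : Fin d → ℤ) k : ℝ) + 1 / 2 * ((w : Fin d → ℤ) k : ℝ) := by
        intro k
        have h1 := congrFun hzw k
        have h2 := (ZMod.intCast_eq_intCast_iff' _ _ 2).1 h1
        have h3 : 2 * m k = (z : Fin d → ℤ) k + (w : Fin d → ℤ) k := by
          simp only [m]
          push_cast at h2
          omega
        have h4 : 2 * (m k : ℝ) = ((z : Fin d → ℤ) k : ℝ) + ((w : Fin d → ℤ) k : ℝ) := by
          exact_mod_cast h3
        linarith
      have havg := hQavg (z := z) (w := w) (m := m) (by norm_num) (by norm_num) (by norm_num) hm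
      refine ⟨⟨m, _, havg _ (hqQ z z) _ (hqQ z w)⟩, fun i => ?_⟩
      have := hqmin i ⟨m, _, havg _ (hqQ z z) _ (hqQ z w)⟩ _ (havg _ (hqQ i z) _ (hqQ i w))
      rw [inner_add_right, inner_smul_right, inner_smul_right] at this
      linarith)
    b (fun z => ⟨z, haQ z _ (hqQ z z)⟩)
  obtain ⟨e⟩ : Nonempty (J ↪ Fin (2 ^ d)) := by
    apply Function.Embedding.nonempty_of_card_le
    simpa using hJ
  -- Unused indices receive the trivial inequality `0 ≤ 1`, a nonzero pair valid everywhere.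
  let p : Fin (2 ^ d) → EuclideanSpace ℝ (Fin (d + n)) × ℝ :=
    Function.extend e (fun i => (a i, b' i)) fun _ => (0, 1)
  have hpe : ∀ i, p (e i) = (a i, b' i) := fun i => e.injective.extend_apply _ _ i
  have hp : ∀ k, (∃ i, e i = k) ∨ p k = (0, 1) := by
    intro k
    by_cases h : ∃ i, e i = k
    · exact Or.inl h
    · exact Or.inr (Function.extend_apply' _ _ _ h)
  refine ⟨p, fun k => ?_, fun k x hx => ?_, fun x hx => ?_⟩
  · rcases hp k with ⟨i, rfl⟩ | h
    · rw [hpe]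
      exact fun h => ha i (congrArg Prod.fst h)
    · rw [h]
      exact fun h => one_ne_zero (congrArg Prod.snd h)
  · rcases hp k with ⟨i, rfl⟩ | h
    · rw [hpe]
      exact (haL i x hx).trans (hbb' i i.2)
    · simp [h]
  · choose z hz using (hF hx).1
    have hxQ : x ∈ Q z := ⟨subset_convexHull ℝ _ hx, hz⟩
    obtain ⟨i, hiJ, hi⟩ := hcov ⟨z, x, hxQ⟩
    refine ⟨e ⟨i, hiJ⟩, ?_⟩
    rw [hpe]
    exact hi.trans (hqmin i ⟨z, x, hxQ⟩ x hxQ)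

/-- Full-dimensional maximal `(ℤ^d × ℝ^n) ∩ C`-free sets are polyhedra with at most `2 ^ d`
facets. -/
theorem facetBound_mixedInteger_inter {d n : ℕ} {C : Set (EuclideanSpace ℝ (Fin (d + n)))}
    (hC : Convex ℝ C) : FacetBound (mixedInteger d n ∩ C) (2 ^ d) := by
  intro L hL hfull
  have hint : (interior L).Nonempty :=
    hL.prop.2.1.interior_nonempty_iff_affineSpan_eq_top.2 hfull
  obtain ⟨u, β, rfl⟩ := hL.exists_eq_of_finite (hint.mono interior_subset)
    (exists_valid_inequalities hC hL.prop hint)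
  exact ⟨⟨_, u, β, rfl⟩, encard_facets_le u β hfull⟩

/-! ### The extremal example -/

/-- The cylinder over the cross-polytope circumscribed about the unit cube `[0, 1]^d`. -/
def crossCylinder (d n : ℕ) : Set (EuclideanSpace ℝ (Fin (d + n))) :=
  {x | ∑ i : Fin d, |x (Fin.castAdd n i) - 1 / 2| ≤ d / 2}

theorem continuous_sum_abs (d n : ℕ) : Continuous fun x : EuclideanSpace ℝ (Fin (d + n)) =>
    ∑ i : Fin d, |x (Fin.castAdd n i) - 1 / 2| := by
  fun_prop

theorem convexOn_sum_abs (d n : ℕ) :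
    ConvexOn ℝ Set.univ fun x : EuclideanSpace ℝ (Fin (d + n)) =>
      ∑ i : Fin d, |x (Fin.castAdd n i) - 1 / 2| := by
  refine ⟨convex_univ, fun x _ y _ a b ha hb hab => ?_⟩
  simp only [smul_eq_mul, Finset.mul_sum, ← Finset.sum_add_distrib]
  refine Finset.sum_le_sum fun i _ => ?_
  have : (a • x + b • y) (Fin.castAdd n i) - 1 / 2 =
      a * (x (Fin.castAdd n i) - 1 / 2) + b * (y (Fin.castAdd n i) - 1 / 2) := by
    simp only [PiLp.add_apply, PiLp.smul_apply, smul_eq_mul]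
    linear_combination (1 / 2 : ℝ) * hab
  rw [this]
  refine (abs_add_le _ _).trans_eq ?_
  rw [abs_mul, abs_mul, abs_of_nonneg ha, abs_of_nonneg hb]

theorem sum_abs_lt_mem_interior {d n : ℕ} {x : EuclideanSpace ℝ (Fin (d + n))}
    (hx : ∑ i : Fin d, |x (Fin.castAdd n i) - 1 / 2| < d / 2) :
    x ∈ interior (crossCylinder d n) :=
  interior_maximal (fun _ hy => le_of_lt hy)
    (isOpen_lt (continuous_sum_abs d n) continuous_const) hx

/-- Interior points of the cross-cylinder satisfy the defining inequality strictly. -/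
theorem sum_abs_lt_of_mem_interior {d n : ℕ} (hd : 1 ≤ d) {x : EuclideanSpace ℝ (Fin (d + n))}
    (hx : x ∈ interior (crossCylinder d n)) :
    ∑ i : Fin d, |x (Fin.castAdd n i) - 1 / 2| < d / 2 := by
  have hd' : (0 : ℝ) < d := by exact_mod_cast hd
  let c : EuclideanSpace ℝ (Fin (d + n)) := WithLp.toLp 2 fun _ => 1 / 2
  have hcont : Continuous fun t : ℝ => x + t • (x - c) := by fun_prop
  -- Pushing `x` away from the center `c` scales the sum by `1 + t`, so equality at an interior
  -- point is impossible.
  have hmem : ∀ᶠ t : ℝ in nhds 0, x + t • (x - c) ∈ crossCylinder d n :=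
    hcont.continuousAt.eventually_mem (by simpa using mem_interior_iff_mem_nhds.1 hx)
  obtain ⟨t, ht, htpos⟩ := ((hmem.filter_mono nhdsWithin_le_nhds).and
    (self_mem_nhdsWithin : Set.Ioi (0 : ℝ) ∈ nhdsWithin 0 (Set.Ioi 0))).exists
  have htpos : 0 < t := htpos
  have h1 : ∑ i : Fin d, |(x + t • (x - c)) (Fin.castAdd n i) - 1 / 2| =
      (1 + t) * ∑ i : Fin d, |x (Fin.castAdd n i) - 1 / 2| := by
    rw [Finset.mul_sum]
    refine Finset.sum_congr rfl fun i _ => ?_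
    rw [← abs_of_pos (show 0 < 1 + t by linarith), ← abs_mul]
    congr 1
    simp [c]
    ring
  have h2 : (1 + t) * ∑ i : Fin d, |x (Fin.castAdd n i) - 1 / 2| ≤ d / 2 := h1 ▸ ht
  nlinarith

/-- The sign `±1` attached to a Boolean. -/
def boolSign (s : Bool) : ℝ := if s then 1 else -1

theorem boolSign_mul_self (s : Bool) : boolSign s * boolSign s = 1 := by
  cases s <;> simp [boolSign]

theorem abs_boolSign (s : Bool) : |boolSign s| = 1 := by
  cases s <;> simp [boolSign]

theorem boolSign_mul_le_abs (s : Bool) (x : ℝ) : boolSign s * x ≤ |x| := by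
  refine (le_abs_self _).trans_eq ?_
  rw [abs_mul, abs_boolSign, one_mul]

/-- A vertex of the unit cube, extended by zero. -/
noncomputable def cubeVertex {d : ℕ} (n : ℕ) (ε : Fin d → Bool) :
    EuclideanSpace ℝ (Fin (d + n)) :=
  WithLp.toLp 2 (Fin.append (fun i => 1 / 2 + boolSign (ε i) / 2) 0)

theorem cubeVertex_castAdd {d : ℕ} (n : ℕ) (ε : Fin d → Bool) (i : Fin d) :
    cubeVertex n ε (Fin.castAdd n i) = 1 / 2 + boolSign (ε i) / 2 := by
  simp [cubeVertex]

theorem cubeVertex_mem_mixedInteger {d : ℕ} (n : ℕ) (ε : Fin d → Bool) :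
    cubeVertex n ε ∈ mixedInteger d n := by
  intro i
  rw [cubeVertex_castAdd]
  cases ε i
  · exact ⟨0, by norm_num [boolSign]⟩
  · exact ⟨1, by norm_num [boolSign]⟩

/-- The signed coordinate sum `x ↦ ∑ i, ε i * x i` over the first `d` coordinates. -/
noncomputable def signedSum {d : ℕ} (n : ℕ) (ε : Fin d → Bool) :
    StrongDual ℝ (EuclideanSpace ℝ (Fin (d + n))) :=
  ∑ i : Fin d, boolSign (ε i) • EuclideanSpace.proj (𝕜 := ℝ) (Fin.castAdd n i)

theorem signedSum_apply {d : ℕ} (n : ℕ) (ε : Fin d → Bool)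
    (x : EuclideanSpace ℝ (Fin (d + n))) :
    signedSum n ε x = ∑ i : Fin d, boolSign (ε i) * x (Fin.castAdd n i) := by
  simp [signedSum]

/-- Near a cube vertex, the sum of absolute values is the signed sum. -/
theorem exists_sum_abs_cubeVertex_add_eq {d n : ℕ} (ε : Fin d → Bool)
    (w : EuclideanSpace ℝ (Fin (d + n))) :
    ∃ t : ℝ, 0 < t ∧
      ∑ i : Fin d, |(cubeVertex n ε + t • w) (Fin.castAdd n i) - 1 / 2| =
        d / 2 + t * signedSum n ε w := by
  have hev : ∀ᶠ t : ℝ in nhds 0, ∀ i : Fin d, 0 < 1 / 2 + t * (boolSign (ε i) *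
      w (Fin.castAdd n i)) := by
    rw [Filter.eventually_all]
    intro i
    have hc : Continuous fun t : ℝ => 1 / 2 + t * (boolSign (ε i) * w (Fin.castAdd n i)) := by
      fun_prop
    exact hc.continuousAt.eventually (lt_mem_nhds (by norm_num))
  obtain ⟨t, ht, htpos⟩ := ((hev.filter_mono nhdsWithin_le_nhds).and
    (self_mem_nhdsWithin : Set.Ioi (0 : ℝ) ∈ nhdsWithin 0 (Set.Ioi 0))).exists
  refine ⟨t, htpos, ?_⟩
  have hterm : ∀ i : Fin d, |(cubeVertex n ε + t • w) (Fin.castAdd n i) - 1 / 2| =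
      1 / 2 + t * (boolSign (ε i) * w (Fin.castAdd n i)) := by
    intro i
    have h1 : (cubeVertex n ε + t • w) (Fin.castAdd n i) - 1 / 2 =
        boolSign (ε i) * (1 / 2 + t * (boolSign (ε i) * w (Fin.castAdd n i))) := by
      simp only [PiLp.add_apply, PiLp.smul_apply, smul_eq_mul, cubeVertex_castAdd]
      linear_combination (-t * w (Fin.castAdd n i)) * boolSign_mul_self (ε i)
    rw [h1, abs_mul, abs_boolSign, one_mul, abs_of_pos (ht i)]
  simp only [hterm, Finset.sum_add_distrib, ← Finset.mul_sum, signedSum_apply]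
  simp
  ring

theorem signedSum_le {d n : ℕ} (ε : Fin d → Bool) {x : EuclideanSpace ℝ (Fin (d + n))}
    (hx : x ∈ crossCylinder d n) :
    signedSum n ε x ≤ signedSum n ε (cubeVertex n ε) := by
  have h1 : signedSum n ε x - signedSum n ε (cubeVertex n ε) =
      ∑ i : Fin d, boolSign (ε i) * (x (Fin.castAdd n i) - 1 / 2) - d / 2 := by
    have : (d : ℝ) / 2 = ∑ i : Fin d, (1 / 2 : ℝ) := by simp; ring
    rw [signedSum_apply, signedSum_apply, this, ← Finset.sum_sub_distrib, ← Finset.sum_sub_distrib]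
    refine Finset.sum_congr rfl fun i _ => ?_
    rw [cubeVertex_castAdd]
    linear_combination (-1 / 2 : ℝ) * boolSign_mul_self (ε i)
  have h2 : ∑ i : Fin d, boolSign (ε i) * (x (Fin.castAdd n i) - 1 / 2) ≤
      ∑ i : Fin d, |x (Fin.castAdd n i) - 1 / 2| :=
    Finset.sum_le_sum fun i _ => boolSign_mul_le_abs _ _
  have h3 : ∑ i : Fin d, |x (Fin.castAdd n i) - 1 / 2| ≤ d / 2 := hx
  linarith

theorem crossCylinder_isSFree {d : ℕ} (n : ℕ) (hd : 1 ≤ d) :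
    IsSFree (mixedInteger d n) (crossCylinder d n) := by
  refine ⟨isClosed_le (continuous_sum_abs d n) continuous_const, ?_, ?_⟩
  · simpa [crossCylinder] using (convexOn_sum_abs d n).convex_le (d / 2)
  · rw [Set.disjoint_left]
    intro x hx hxM
    have hlt := sum_abs_lt_of_mem_interior hd hx
    have hge : ∑ i : Fin d, (1 / 2 : ℝ) ≤ ∑ i : Fin d, |x (Fin.castAdd n i) - 1 / 2| := by
      refine Finset.sum_le_sum fun i _ => ?_
      obtain ⟨z, hz⟩ := hxM i
      rw [hz, le_abs]
      rcases le_or_gt z 0 with h | h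
      · right
        have : (z : ℝ) ≤ 0 := by exact_mod_cast h
        linarith
      · left
        have : (1 : ℝ) ≤ z := by exact_mod_cast h
        linarith
    simp only [Finset.sum_const, Finset.card_univ, Fintype.card_fin, nsmul_eq_mul] at hge
    linarith

/-- For `y` outside, take the cube vertex in the orthant of `y` about the center. Just past the
vertex, on the side away from `y`, the ray from `y` enters the interior of the cylinder. A convex
set containing both `y` and the cylinder therefore has this mixed-integer vertex in its interior. -/
theorem crossCylinder_isMaximalSFree {d : ℕ} (n : ℕ) (hd : 1 ≤ d) :
    IsMaximalSFree (mixedInteger d n) (crossCylinder d n) := by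
  refine ⟨crossCylinder_isSFree n hd, fun L' hL' hle y hy => ?_⟩
  by_contra hyL
  have hygt : (d : ℝ) / 2 < ∑ i : Fin d, |y (Fin.castAdd n i) - 1 / 2| := not_le.1 hyL
  let ε : Fin d → Bool := fun i => decide (1 / 2 ≤ y (Fin.castAdd n i))
  have hε : ∀ i, |y (Fin.castAdd n i) - 1 / 2| = boolSign (ε i) * (y (Fin.castAdd n i) - 1 / 2) := by
    intro i
    by_cases h : 1 / 2 ≤ y (Fin.castAdd n i)
    · rw [abs_of_nonneg (by linarith)]
      simp only [ε, boolSign, h, decide_true, if_true, one_mul]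
    · rw [abs_of_neg (by linarith)]
      simp only [ε, boolSign, h, decide_false, if_false, Bool.false_eq_true]
      ring
  obtain ⟨t, ht, hsum⟩ := exists_sum_abs_cubeVertex_add_eq ε (cubeVertex n ε - y)
  have hneg : signedSum n ε (cubeVertex n ε - y) < 0 := by
    have : signedSum n ε (cubeVertex n ε - y) =
        d / 2 - ∑ i : Fin d, |y (Fin.castAdd n i) - 1 / 2| := by
      have : (d : ℝ) / 2 = ∑ i : Fin d, (1 / 2 : ℝ) := by simp; ring
      rw [signedSum_apply, this, ← Finset.sum_sub_distrib]
      refine Finset.sum_congr rfl fun i _ => ?_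
      rw [hε, PiLp.sub_apply, cubeVertex_castAdd]
      linear_combination (1 / 2 : ℝ) * boolSign_mul_self (ε i)
    linarith
  have hw : cubeVertex n ε + t • (cubeVertex n ε - y) ∈ interior L' := by
    refine interior_mono hle (sum_abs_lt_mem_interior ?_)
    rw [hsum]
    have := mul_neg_of_pos_of_neg ht hneg
    linarith
  refine Set.disjoint_left.1 hL'.2.2 ?_ (cubeVertex_mem_mixedInteger n ε)
  refine hL'.2.1.openSegment_interior_self_subset_interior hw hy
    ⟨1 / (1 + t), t / (1 + t), by positivity, by positivity, by field_simp, ?_⟩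
  have h1 : (1 + t) ≠ 0 := by positivity
  ext i
  simp only [PiLp.add_apply, PiLp.smul_apply, PiLp.sub_apply, smul_eq_mul]
  field_simp
  ring

theorem crossCylinder_isFullDimensional {d : ℕ} (n : ℕ) (hd : 1 ≤ d) :
    IsFullDimensional (crossCylinder d n) := by
  refine ((crossCylinder_isSFree n hd).2.1.interior_nonempty_iff_affineSpan_eq_top).1
    ⟨WithLp.toLp 2 fun _ => 1 / 2, sum_abs_lt_mem_interior ?_⟩
  have hd' : (0 : ℝ) < d := by exact_mod_cast hd
  simpa using hd'

/-- The points of the cross-cylinder that maximize a signed sum. -/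
def signedFacet {d : ℕ} (n : ℕ) (ε : Fin d → Bool) : Set (EuclideanSpace ℝ (Fin (d + n))) :=
  {x ∈ crossCylinder d n | ∀ y ∈ crossCylinder d n, signedSum n ε y ≤ signedSum n ε x}

theorem cubeVertex_mem_crossCylinder {d : ℕ} (n : ℕ) (ε : Fin d → Bool) :
    cubeVertex n ε ∈ crossCylinder d n := by
  obtain ⟨t, -, h⟩ := exists_sum_abs_cubeVertex_add_eq (n := n) ε 0
  rw [smul_zero, add_zero, map_zero, mul_zero, add_zero] at h
  exact h.le

theorem cubeVertex_mem_signedFacet {d : ℕ} (n : ℕ) (ε : Fin d → Bool) :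
    cubeVertex n ε ∈ signedFacet n ε :=
  ⟨cubeVertex_mem_crossCylinder n ε, fun _ hy => signedSum_le ε hy⟩

/-- At the cube vertex no summand vanishes, so a small move along any `w` in the kernel of the
signed sum stays in the facet. The facet thus spans that kernel, a hyperplane. -/
theorem signedFacet_isFacet {d : ℕ} (n : ℕ) (hd : 1 ≤ d) (ε : Fin d → Bool) :
    IsFacet (crossCylinder d n) (signedFacet n ε) := by
  refine ⟨fun _ => ⟨signedSum n ε, rfl⟩, ⟨_, cubeVertex_mem_signedFacet n ε⟩, ?_⟩
  have hφ0 : (signedSum n ε).toLinearMap ≠ 0 := by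
    intro h
    have h1 := LinearMap.congr_fun h (EuclideanSpace.single (Fin.castAdd n ⟨0, hd⟩) 1)
    have h2 : signedSum n ε (EuclideanSpace.single (Fin.castAdd n ⟨0, hd⟩) 1) = 0 := h1
    rw [signedSum_apply, Finset.sum_eq_single ⟨0, hd⟩] at h2
    · have := boolSign_mul_self (ε ⟨0, hd⟩)
      simp at h2
      simp [h2] at this
    · intro i _ hi
      have : Fin.castAdd n i ≠ Fin.castAdd n ⟨0, hd⟩ :=
        fun h => hi (Fin.castAdd_injective d n h)
      rw [PiLp.single_apply, if_neg this, mul_zero]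
    · simp
  have hspan : vectorSpan ℝ (signedFacet n ε) = LinearMap.ker (signedSum n ε).toLinearMap := by
    apply le_antisymm
    · rw [vectorSpan_def, Submodule.span_le]
      rintro _ ⟨a, ha, b, hb, rfl⟩
      have := le_antisymm (ha.2 b hb.1) (hb.2 a ha.1)
      simp [this]
    · intro w hw
      have hw : signedSum n ε w = 0 := hw
      obtain ⟨t, ht, hsum⟩ := exists_sum_abs_cubeVertex_add_eq ε w
      rw [hw, mul_zero, add_zero] at hsum
      have hmem : cubeVertex n ε + t • w ∈ signedFacet n ε := by
        refine ⟨hsum.le, fun y hy => ?_⟩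
        rw [map_add, map_smul, hw, smul_zero, add_zero]
        exact signedSum_le ε hy
      have h1 := vsub_mem_vectorSpan ℝ hmem (cubeVertex_mem_signedFacet n ε)
      rw [vsub_eq_sub, add_sub_cancel_left] at h1
      exact (Submodule.smul_mem_iff _ ht.ne').1 h1
  have htop : vectorSpan ℝ (crossCylinder d n) = ⊤ := by
    have : affineSpan ℝ (crossCylinder d n) = ⊤ := crossCylinder_isFullDimensional n hd
    rw [← direction_affineSpan, this, AffineSubspace.direction_top]
  rw [hspan, htop, finrank_top]
  exact Module.Dual.finrank_ker_add_one_of_ne_zero hφ0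

/-- Among cube vertices, the signed sum of `δ` is maximized coordinatewise and only at the vertex of
`δ`. -/
theorem signedFacet_injective (d n : ℕ) :
    Function.Injective (signedFacet n : (Fin d → Bool) → Set _) := by
  intro ε δ h
  have h1 : cubeVertex n ε ∈ signedFacet n δ := h ▸ cubeVertex_mem_signedFacet n ε
  have h2 := h1.2 _ (cubeVertex_mem_crossCylinder n δ)
  rw [signedSum_apply, signedSum_apply] at h2
  have hle : ∀ i ∈ Finset.univ, boolSign (δ i) * cubeVertex n ε (Fin.castAdd n i) ≤
      boolSign (δ i) * cubeVertex n δ (Fin.castAdd n i) := by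
    intro i _
    rw [cubeVertex_castAdd, cubeVertex_castAdd]
    cases ε i <;> cases δ i <;> norm_num [boolSign]
  have heq := (Finset.sum_eq_sum_iff_of_le hle).1 (le_antisymm (Finset.sum_le_sum hle) h2)
  funext i
  have h3 := heq i (Finset.mem_univ i)
  rw [cubeVertex_castAdd, cubeVertex_castAdd] at h3
  revert h3
  cases ε i <;> cases δ i <;> norm_num [boolSign]

theorem le_encard_facets_crossCylinder {d : ℕ} (n : ℕ) (hd : 1 ≤ d) :
    ((2 ^ d : ℕ) : ℕ∞) ≤ {F | IsFacet (crossCylinder d n) F}.encard := by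
  calc ((2 ^ d : ℕ) : ℕ∞) = (Set.univ : Set (Fin d → Bool)).encard := by
        simp [Set.encard_univ]
    _ = (signedFacet n '' (Set.univ : Set (Fin d → Bool))).encard :=
        ((signedFacet_injective d n).encard_image _).symm
    _ ≤ _ := Set.encard_le_encard (by
        rintro _ ⟨ε, -, rfl⟩
        exact signedFacet_isFacet n hd ε)

/-! ### Translation to `facetComplexity` -/

theorem facetComplexity_le_of_facetBound {N k : ℕ} {S : Set (EuclideanSpace ℝ (Fin N))}
    (h : FacetBound S k) : facetComplexity S ≤ ((k : ℕ) : EReal) := by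
  classical
  unfold facetComplexity
  split_ifs with h1 h2
  · exact_mod_cast Nat.find_min' h2 h
  · exact absurd ⟨k, h⟩ h2
  · exact bot_le

theorem le_facetComplexity {N k : ℕ} {S L : Set (EuclideanSpace ℝ (Fin N))}
    (hL : IsMaximalSFree S L) (hfull : IsFullDimensional L)
    (hk : (k : ℕ∞) ≤ {F | IsFacet L F}.encard) : ((k : ℕ) : EReal) ≤ facetComplexity S := by
  classical
  unfold facetComplexity
  split_ifs with h1 h2
  · have := hk.trans (Nat.find_spec h2 L hL hfull).2
    exact_mod_cast this
  · exact le_top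
  · exact absurd ⟨L, hL, hfull⟩ h1

theorem theorem5 (d n : ℕ) (hd : 1 ≤ d) :
    (∀ C : Set (EuclideanSpace ℝ (Fin (d + n))), Convex ℝ C →
      facetComplexity (mixedInteger d n ∩ C) ≤ ((2 ^ d : ℕ) : EReal)) ∧
    facetComplexity (mixedInteger d n ∩ Set.univ) = ((2 ^ d : ℕ) : EReal) := by
  refine ⟨fun C hC => facetComplexity_le_of_facetBound (facetBound_mixedInteger_inter hC),
    le_antisymm (facetComplexity_le_of_facetBound (facetBound_mixedInteger_inter convex_univ)) ?_⟩
  rw [Set.inter_univ]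
  exact le_facetComplexity (crossCylinder_isMaximalSFree n hd)
    (crossCylinder_isFullDimensional n hd) (le_encard_facets_crossCylinder n hd)
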